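/- Let $\kappa$ be a regular cardinal and let $\lambda<\kappa$ be a smaller infinite cardinal. A locally small category is called $\kappa$-accessible if it has all $\kappa$-directed colimits and admits a set of $\kappa$-presentable objects such that every object is a $\kappa$-directed colimit of objects from this set; here an object $S$ is $\kappa$-presentable if $\mathrm{Hom}(S,-)$ preserves $\kappa$-directed colimits. A $\lambda$-indexed chain in a category is a functor into it from the ordered set $\lambda$. Let $\mathbf{ACC}^\kappa_{\lambda,\kappa}$ be the following $2$-subcategory of the $2$-category $\mathbf{CAT}$ of locally small categories: the objects are the $\kappa$-accessible categories in which all $\lambda$-indexed chains have colimits; the $1$-cells are the functors that preserve $\kappa$-directed colimits and colimits of $\lambda$-indexed chains and take $\kappa$-presentable objects to $\kappa$-presentable objects; the $2$-cells are all natural transformations. Let $\Gamma$ be a $\kappa$-small (strict) $2$-category, that is, one with fewer than $\kappa$ objects, fewer than $\kappa$ $1$-cells and fewer than $\kappa$ $2$-cells, and let $H\colon\Gamma\to\mathbf{ACC}^\kappa_{\lambda,\kappa}$ be a (strict) $2$-functor. The (conical) lax limit of $H$, computed in $\mathbf{CAT}$, is the category $\mathsf L$ defined as follows. An object $L$ of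 $\mathsf L$ consists of an object $L_\gamma\in H(\gamma)$ for every object $\gamma\in\Gamma$ and a morphism $l_a\colon H(a)(L_\gamma)\to L_\delta$ in $H(\delta)$ for every $1$-cell $a\colon\gamma\to\delta$ in $\Gamma$, such that $l_{\mathrm{id}_\gamma}=\mathrm{id}_{L_\gamma}$ for every $\gamma$, $l_{ba}=l_b\circ H(b)(l_a)$ for all composable $1$-cells $a\colon\gamma\to\delta$, $b\colon\delta\to\epsilon$, and $l_b\circ H(t)_{L_\gamma}=l_a$ for every $2$-cell $t\colon a\to b$ between parallel $1$-cells $a,b\colon\gamma\to\delta$. A morphism $f\colon L\to M$ in $\mathsf L$ is a family of morphisms $f_\gamma\colon L_\gamma\to M_\gamma$ in $H(\gamma)$, for all $\gamma\in\Gamma$, such that $m_a\circ H(a)(f_\gamma)=f_\delta\circ l_a$ for every $1$-cell $a\colon\gamma\to\delta$. Then: 1. the category $\mathsf L$ belongs to $\mathbf{ACC}^\kappa_{\lambda,\kappa}$, i.e. it is $\kappa$-accessible and has colimits of $\lambda$-indexed chains; 2. for every object $\gamma\in\Gamma$, the projection functor $\mathsf L\to H(\gamma)$, $L\mapsto L_\gamma$,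 belongs to $\mathbf{ACC}^\kappa_{\lambda,\kappa}$, i.e. it preserves $\kappa$-directed colimits and colimits of $\lambda$-indexed chains and takes $\kappa$-presentable objects to $\kappa$-presentable objects; 3. an object $S\in\mathsf L$ is $\kappa$-presentable if and only if, for every object $\gamma\in\Gamma$, the object $S_\gamma\in H(\gamma)$ is $\kappa$-presentable. -/

import Mathlib

open CategoryTheory CategoryTheory.Limits CategoryTheory.Bicategory

universe w v v' v'' u u' u''

/-! Throughout, "sets" live in the universe `w`: the cardinals `κ` and `lam` are elements of
`Cardinal.{w}`, small `2`-categories have objects and cells in `Type w`, and locally small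
categories have their hom-sets in `Type w` and their objects in an arbitrary universe `u`. -/

/-- A strict `2`-category is `κ`-small if it has less than `κ` objects, less than `κ` `1`-cells
and less than `κ` `2`-cells. -/
structure IsSmallTwoCategory (κ : Cardinal.{w}) (Γ : Type w) [Bicategory.{w, w} Γ] : Prop where
  objects : HasCardinalLT Γ κ
  oneCells : HasCardinalLT (Σ (γ δ : Γ), γ ⟶ δ) κ
  twoCells : HasCardinalLT (Σ (γ δ : Γ) (a b : γ ⟶ δ), a ⟶ b) κ

/-- The objects of `ACC^κ_{lam,κ}`: `κ`-accessible categories with colimits of `lam`-indexed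
chains, the cardinal `lam` being regarded as a totally ordered set (an initial ordinal). -/
structure IsAccCategory (κ lam : Cardinal.{w}) [Fact κ.IsRegular]
    (C : Type u) [Category.{v} C] : Prop where
  accessible : IsCardinalAccessibleCategory C κ
  chains : HasColimitsOfShape lam.ord.ToType C

/-- The `1`-cells of `ACC^κ_{lam,κ}`: functors preserving `κ`-directed (equivalently,
`κ`-filtered) colimits and colimits of `lam`-indexed chains, and taking `κ`-presentable objects
to `κ`-presentable objects. -/
structure IsAccFunctor (κ lam : Cardinal.{w}) [Fact κ.IsRegular]
    {C : Type u} [Category.{v} C] {D : Type u'} [Category.{v'} D] (F : C ⥤ D) : Prop where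
  directedColimits : F.IsCardinalAccessible κ
  chains : PreservesColimitsOfShape lam.ord.ToType F
  presentable : ∀ X : C, IsCardinalPresentable X κ → IsCardinalPresentable (F.obj X) κ

theorem IsAccFunctor.id (κ lam : Cardinal.{w}) [Fact κ.IsRegular]
    (C : Type u) [Category.{v} C] : IsAccFunctor κ lam (𝟭 C) where
  directedColimits := ⟨fun _ _ _ => inferInstance⟩
  chains := inferInstance
  presentable _ h := h

theorem IsAccFunctor.comp {κ lam : Cardinal.{w}} [Fact κ.IsRegular]
    {C : Type u} [Category.{v} C] {D : Type u'} [Category.{v'} D]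
    {E : Type u''} [Category.{v''} E] {F : C ⥤ D} {G : D ⥤ E}
    (hF : IsAccFunctor κ lam F) (hG : IsAccFunctor κ lam G) :
    IsAccFunctor κ lam (F ⋙ G) where
  directedColimits := ⟨fun J _ _ => by
    have := hF.directedColimits.preservesColimitOfShape J
    have := hG.directedColimits.preservesColimitOfShape J
    infer_instance⟩
  chains := by
    have := hF.chains
    have := hG.chains
    infer_instance
  presentable X h := hG.presentable _ (hF.presentable X h)

/-- The objects of the `2`-subcategory `ACC^κ_{lam,κ}` of `CAT`. -/
structure AccCat (κ lam : Cardinal.{w}) [Fact κ.IsRegular] where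
  cat : Cat.{w, u}
  prop : IsAccCategory κ lam cat

namespace AccCat

variable {κ lam : Cardinal.{w}} [Fact κ.IsRegular]

/-- A `1`-cell of `ACC^κ_{lam,κ}`. -/
structure Hom (X Y : AccCat.{w, u} κ lam) where
  hom : X.cat ⟶ Y.cat
  prop : IsAccFunctor κ lam hom.toFunctor

instance : CategoryStruct (AccCat.{w, u} κ lam) where
  Hom X Y := Hom X Y
  id X := ⟨𝟙 X.cat, IsAccFunctor.id κ lam X.cat⟩
  comp f g := ⟨f.hom ≫ g.hom, f.prop.comp g.prop⟩

/-- A `2`-cell of `ACC^κ_{lam,κ}`: an arbitrary natural transformation. -/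
@[ext]
structure Hom₂ {X Y : AccCat.{w, u} κ lam} (f g : X ⟶ Y) where
  hom : f.hom ⟶ g.hom

instance homCategory (X Y : AccCat.{w, u} κ lam) : Category (X ⟶ Y) where
  Hom f g := Hom₂ f g
  id f := ⟨𝟙 f.hom⟩
  comp s t := ⟨s.hom ≫ t.hom⟩
  id_comp _ := Hom₂.ext (Category.id_comp _)
  comp_id _ := Hom₂.ext (Category.comp_id _)
  assoc _ _ _ := Hom₂.ext (Category.assoc _ _ _)

@[ext]
theorem hom₂_ext {X Y : AccCat.{w, u} κ lam} {f g : X ⟶ Y} {s t : f ⟶ g}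
    (h : s.hom = t.hom) : s = t := Hom₂.ext h

@[simp]
theorem id_hom (X : AccCat.{w, u} κ lam) : (𝟙 X : X ⟶ X).hom = 𝟙 X.cat := rfl

@[simp]
theorem comp_hom {X Y Z : AccCat.{w, u} κ lam} (f : X ⟶ Y) (g : Y ⟶ Z) :
    (f ≫ g).hom = f.hom ≫ g.hom := rfl

@[simp]
theorem id₂_hom {X Y : AccCat.{w, u} κ lam} (f : X ⟶ Y) : (𝟙 f : f ⟶ f).hom = 𝟙 f.hom := rfl

@[simp]
theorem comp₂_hom {X Y : AccCat.{w, u} κ lam} {f g h : X ⟶ Y} (s : f ⟶ g) (t : g ⟶ h) :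
    (s ≫ t).hom = s.hom ≫ t.hom := rfl

/-- Invertible `2`-cells of `CAT` are invertible in `ACC^κ_{lam,κ}`. -/
@[simps]
def isoMk {X Y : AccCat.{w, u} κ lam} {f g : X ⟶ Y} (e : f.hom ≅ g.hom) : f ≅ g where
  hom := ⟨e.hom⟩
  inv := ⟨e.inv⟩

/-- The `2`-category `ACC^κ_{lam,κ}`, with all compositions taken in the `2`-category of
categories. -/
instance : Bicategory (AccCat.{w, u} κ lam) where
  homCategory := homCategory
  whiskerLeft f _ _ t := Hom₂.mk (f.hom ◁ t.hom)
  whiskerRight t g := Hom₂.mk (t.hom ▷ g.hom)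
  associator f g h := isoMk (f := (f ≫ g) ≫ h) (g := f ≫ g ≫ h) (α_ f.hom g.hom h.hom)
  leftUnitor {X _} f := isoMk (f := 𝟙 X ≫ f) (g := f) (λ_ f.hom)
  rightUnitor {_ Y} f := isoMk (f := f ≫ 𝟙 Y) (g := f) (ρ_ f.hom)
  whiskerLeft_id _ _ := hom₂_ext (Bicategory.whiskerLeft_id _ _)
  whiskerLeft_comp _ _ _ _ _ _ := hom₂_ext (Bicategory.whiskerLeft_comp _ _ _)
  id_whiskerLeft _ := hom₂_ext (Bicategory.id_whiskerLeft _)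
  comp_whiskerLeft _ _ _ _ _ := hom₂_ext (Bicategory.comp_whiskerLeft _ _ _)
  id_whiskerRight _ _ := hom₂_ext (Bicategory.id_whiskerRight _ _)
  comp_whiskerRight _ _ _ := hom₂_ext (Bicategory.comp_whiskerRight _ _ _)
  whiskerRight_id _ := hom₂_ext (Bicategory.whiskerRight_id _)
  whiskerRight_comp _ _ _ := hom₂_ext (Bicategory.whiskerRight_comp _ _ _)
  whisker_assoc _ _ _ _ _ := hom₂_ext (Bicategory.whisker_assoc _ _ _)
  whisker_exchange _ _ := hom₂_ext (Bicategory.whisker_exchange _ _)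
  pentagon _ _ _ _ := hom₂_ext (Bicategory.pentagon _ _ _ _)
  triangle _ _ := hom₂_ext (Bicategory.triangle _ _)

@[simp]
theorem eqToHom_hom {X Y : AccCat.{w, u} κ lam} {f g : X ⟶ Y} (h : f = g) :
    (eqToHom h).hom = eqToHom (congrArg Hom.hom h) := by
  subst h; rfl

instance : Bicategory.Strict (AccCat.{w, u} κ lam) where
  id_comp _ := rfl
  comp_id _ := rfl
  assoc _ _ _ := rfl
  leftUnitor_eqToIso _ := rfl
  rightUnitor_eqToIso _ := rfl
  associator_eqToIso _ _ _ := rfl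

variable (κ lam) in
/-- The inclusion `2`-functor of `ACC^κ_{lam,κ}` into the `2`-category of categories. -/
@[simps!]
def inclusion : StrictPseudofunctor (AccCat.{w, u} κ lam) Cat.{w, u} :=
  StrictPseudofunctor.mk' {
    obj X := X.cat
    map f := f.hom
    map₂ t := t.hom }

end AccCat

/-- An object of the (conical) lax limit of a `2`-functor `H : Γ ⟶ CAT`. -/
structure LaxLimit {Γ : Type w} [Bicategory.{w, w} Γ]
    (H : StrictPseudofunctor Γ Cat.{w, u}) where
  obj : ∀ γ : Γ, H.obj γ
  str : ∀ {γ δ : Γ} (a : γ ⟶ δ), (H.map a).toFunctor.obj (obj γ) ⟶ obj δ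
  /-- `l_{id} = id`; the `eqToHom` is the identity morphism of `H(id)(L_γ) = L_γ`. -/
  str_id : ∀ γ : Γ, str (𝟙 γ) = eqToHom (by rw [H.map_id]; rfl)
  /-- `l_{ba} = l_b ∘ H(b)(l_a)`; the `eqToHom` is the identity morphism of
  `H(ba)(L_γ) = H(b)(H(a)(L_γ))`. -/
  str_comp : ∀ {γ δ δ' : Γ} (a : γ ⟶ δ) (b : δ ⟶ δ'),
    str (a ≫ b) = eqToHom (by rw [H.map_comp]; rfl) ≫
      (H.map b).toFunctor.map (str a) ≫ str b
  str_twoCell : ∀ {γ δ : Γ} {a b : γ ⟶ δ} (t : a ⟶ b),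
    (H.map₂ t).toNatTrans.app (obj γ) ≫ str b = str a

namespace LaxLimit

variable {Γ : Type w} [Bicategory.{w, w} Γ] {H : StrictPseudofunctor Γ Cat.{w, u}}

/-- A morphism in the lax limit. -/
@[ext]
structure Hom (L M : LaxLimit H) where
  app : ∀ γ : Γ, L.obj γ ⟶ M.obj γ
  comm : ∀ {γ δ : Γ} (a : γ ⟶ δ),
    (H.map a).toFunctor.map (app γ) ≫ M.str a = L.str a ≫ app δ

instance : Category.{w} (LaxLimit H) where
  Hom L M := Hom L M
  id L := { app := fun γ => 𝟙 (L.obj γ), comm := by simp }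
  comp f g :=
    { app := fun γ => f.app γ ≫ g.app γ
      comm := fun a => by
        rw [Functor.map_comp, Category.assoc, g.comm, ← Category.assoc, f.comm, Category.assoc] }
  id_comp _ := Hom.ext (funext fun _ => Category.id_comp _)
  comp_id _ := Hom.ext (funext fun _ => Category.comp_id _)
  assoc _ _ _ := Hom.ext (funext fun _ => Category.assoc _ _ _)

/-- The forgetful/projection functor from the lax limit of `H` to `H(γ)`. -/
@[simps]
def proj (H : StrictPseudofunctor Γ Cat.{w, u}) (γ : Γ) : LaxLimit H ⥤ H.obj γ where
  obj L := L.obj γ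
  map f := f.app γ

end LaxLimit

/-! The functors H(a) preserve κ-directed colimits and colimits of λ-chains, so these colimits exist
in the lax limit and are computed componentwise (`LaxLimit.isColimitOfProj`). An object S whose
components are κ-presentable is itself κ-presentable (`isCardinalPresentable_of_forall`): a morphism
out of S is a family of maps S_γ → M_γ subject to fewer than κ equations between maps out of the
κ-presentable objects H(a)(S_γ), and fewer than κ such conditions can be met at one stage of a
κ-filtered colimit.

The main point is that these objects generate. Given L, present all components L_γ as colimits of
κ-presentable objects over one κ-directed poset I. Each structure map of L lifts to the terms of
these presentations, but only from an index i to a later index, and the lifts satisfy naturality and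
the lax limit axioms only after passing to a still later index (`exists_compatible`). No single
index therefore gives an object of the lax limit. A λ-chain of indices, each large enough for all
the compatibilities among its predecessors, does: in the colimit of the chain the delays disappear,
because λ has no last element. The components of this colimit stay κ-presentable because λ < κ.

Fewer than κ such chains have fewer than κ terms altogether, so a further chain can be built beyond
all of them. Hence the chains form a κ-directed preorder, and L is the colimit of the associated
objects, since every index lies below a term of some chain (`nonempty_isColimit_proj`).

Finally, a κ-presentable object is a retract of a generator, and projections preserve retracts; this
gives the description of all κ-presentable objects. -/

namespace LaxLimit

variable {Γ : Type w} [Bicategory.{w, w} Γ] {H : StrictPseudofunctor Γ Cat.{w, u}}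

/-! ### Calculus of morphisms and of the identifications coming from strictness. -/

@[ext]
theorem hom_ext {L M : LaxLimit H} {f g : L ⟶ M} (h : ∀ γ, Hom.app f γ = Hom.app g γ) :
    f = g := Hom.ext (funext h)

theorem hom_comm {L M : LaxLimit H} (f : L ⟶ M) {γ δ : Γ} (a : γ ⟶ δ) :
    (H.map a).toFunctor.map (Hom.app f γ) ≫ M.str a = L.str a ≫ Hom.app f δ := f.comm a

theorem hom_comm_assoc {L M : LaxLimit H} (f : L ⟶ M) {γ δ : Γ} (a : γ ⟶ δ) {X : H.obj δ}
    (h : M.obj δ ⟶ X) :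
    (H.map a).toFunctor.map (Hom.app f γ) ≫ M.str a ≫ h = L.str a ≫ Hom.app f δ ≫ h := by
  rw [← Category.assoc, hom_comm, Category.assoc]

variable (H) in
theorem map_id_obj (γ : Γ) (X : H.obj γ) : (H.map (𝟙 γ)).toFunctor.obj X = X := by
  rw [H.map_id]; rfl

variable (H) in
theorem map_comp_obj {γ δ δ' : Γ} (a : γ ⟶ δ) (b : δ ⟶ δ') (X : H.obj γ) :
    (H.map (a ≫ b)).toFunctor.obj X =
      (H.map b).toFunctor.obj ((H.map a).toFunctor.obj X) := by
  rw [H.map_comp]; rfl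

variable (H) in
theorem map_id_naturality (γ : Γ) {X Y : H.obj γ} (f : X ⟶ Y) :
    (H.map (𝟙 γ)).toFunctor.map f ≫ eqToHom (map_id_obj H γ Y) =
      eqToHom (map_id_obj H γ X) ≫ f := by
  have h : (H.map (𝟙 γ)).toFunctor = 𝟭 _ := by rw [H.map_id]; rfl
  have := Functor.congr_hom h f
  simp [this]

variable (H) in
theorem map_comp_naturality {γ δ δ' : Γ} (a : γ ⟶ δ) (b : δ ⟶ δ') {X Y : H.obj γ} (f : X ⟶ Y) :
    (H.map (a ≫ b)).toFunctor.map f ≫ eqToHom (map_comp_obj H a b Y) =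
      eqToHom (map_comp_obj H a b X) ≫
        (H.map b).toFunctor.map ((H.map a).toFunctor.map f) := by
  have h : (H.map (a ≫ b)).toFunctor = (H.map a).toFunctor ⋙ (H.map b).toFunctor := by
    rw [H.map_comp]; rfl
  have := Functor.congr_hom h f
  simp [this]

variable (H) in
theorem map_comp_naturality_assoc {γ δ δ' : Γ} (a : γ ⟶ δ) (b : δ ⟶ δ') {X Y : H.obj γ}
    (f : X ⟶ Y) {Z : H.obj δ'}
    (h : (H.map b).toFunctor.obj ((H.map a).toFunctor.obj Y) ⟶ Z) :
    (H.map (a ≫ b)).toFunctor.map f ≫ eqToHom (map_comp_obj H a b Y) ≫ h =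
      eqToHom (map_comp_obj H a b X) ≫
        (H.map b).toFunctor.map ((H.map a).toFunctor.map f) ≫ h := by
  rw [← Category.assoc, map_comp_naturality, Category.assoc]

variable (H) in
theorem map₂_naturality {γ δ : Γ} {a b : γ ⟶ δ} (t : a ⟶ b) {X Y : H.obj γ} (f : X ⟶ Y) :
    (H.map a).toFunctor.map f ≫ (H.map₂ t).toNatTrans.app Y =
      (H.map₂ t).toNatTrans.app X ≫ (H.map b).toFunctor.map f :=
  (H.map₂ t).toNatTrans.naturality f

variable (H) in
theorem map₂_naturality_assoc {γ δ : Γ} {a b : γ ⟶ δ} (t : a ⟶ b) {X Y : H.obj γ} (f : X ⟶ Y)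
    {Z : H.obj δ} (h : (H.map b).toFunctor.obj Y ⟶ Z) :
    (H.map a).toFunctor.map f ≫ (H.map₂ t).toNatTrans.app Y ≫ h =
      (H.map₂ t).toNatTrans.app X ≫ (H.map b).toFunctor.map f ≫ h := by
  rw [← Category.assoc, map₂_naturality, Category.assoc]

end LaxLimit

/-! ### Lax structures on pointwise colimits. -/

/-- Diagrams `diag γ : J ⥤ H γ` with colimits preserved by the functors `H a`, together with
the data of compatible lax structure maps into their colimits. -/
structure LaxDiagram {Γ : Type w} [Bicategory.{w, w} Γ] (H : StrictPseudofunctor Γ Cat.{w, u})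
    (J : Type v) [Category.{v'} J] where
  diag (γ : Γ) : J ⥤ H.obj γ
  cocone (γ : Γ) : Cocone (diag γ)
  isColimit (γ : Γ) : IsColimit (cocone γ)
  preserves {γ δ : Γ} (a : γ ⟶ δ) : PreservesColimit (diag γ) (H.map a).toFunctor
  str {γ δ : Γ} (a : γ ⟶ δ) (j : J) :
    (H.map a).toFunctor.obj ((diag γ).obj j) ⟶ (cocone δ).pt
  str_naturality {γ δ : Γ} (a : γ ⟶ δ) {j j' : J} (f : j ⟶ j') :
    (H.map a).toFunctor.map ((diag γ).map f) ≫ str a j' = str a j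
  str_id (γ : Γ) (j : J) :
    str (𝟙 γ) j = eqToHom (LaxLimit.map_id_obj H γ _) ≫ (cocone γ).ι.app j
  str_twoCell {γ δ : Γ} {a b : γ ⟶ δ} (t : a ⟶ b) (j : J) :
    (H.map₂ t).toNatTrans.app ((diag γ).obj j) ≫ str b j = str a j
  -- The composition axiom cannot be stated directly, since `str b` is defined on terms and not on
  -- the colimit where `str a j` lands. It is stated through a factorization of `str a j` over some
  -- term j'.
  exists_lift {γ δ : Γ} (a : γ ⟶ δ) (j : J) :
    ∃ (j' : J) (g : (H.map a).toFunctor.obj ((diag γ).obj j) ⟶ (diag δ).obj j'),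
      g ≫ (cocone δ).ι.app j' = str a j ∧
      ∀ {δ' : Γ} (b : δ ⟶ δ'), str (a ≫ b) j =
        eqToHom (LaxLimit.map_comp_obj H a b _) ≫ (H.map b).toFunctor.map g ≫ str b j'

namespace LaxDiagram

variable {Γ : Type w} [Bicategory.{w, w} Γ] {H : StrictPseudofunctor Γ Cat.{w, u}}
  {J : Type v} [Category.{v'} J] (D : LaxDiagram H J)

/-- The image under `H a` of the colimit cocone. -/
noncomputable def isColimitMap {γ δ : Γ} (a : γ ⟶ δ) :
    IsColimit ((H.map a).toFunctor.mapCocone (D.cocone γ)) :=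
  have := D.preserves a
  isColimitOfPreserves _ (D.isColimit γ)

theorem map_hom_ext {γ δ : Γ} (a : γ ⟶ δ) {X : H.obj δ}
    {f g : (H.map a).toFunctor.obj (D.cocone γ).pt ⟶ X}
    (h : ∀ j, (H.map a).toFunctor.map ((D.cocone γ).ι.app j) ≫ f =
      (H.map a).toFunctor.map ((D.cocone γ).ι.app j) ≫ g) : f = g :=
  (D.isColimitMap a).hom_ext h

/-- The structure map on the colimits. -/
noncomputable def desc {γ δ : Γ} (a : γ ⟶ δ) :
    (H.map a).toFunctor.obj (D.cocone γ).pt ⟶ (D.cocone δ).pt :=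
  (D.isColimitMap a).desc
    { pt := (D.cocone δ).pt
      ι :=
        { app j := D.str a j
          naturality _ _ f := (D.str_naturality a f).trans (Category.comp_id _).symm } }

theorem ι_desc {γ δ : Γ} (a : γ ⟶ δ) (j : J) :
    (H.map a).toFunctor.map ((D.cocone γ).ι.app j) ≫ D.desc a = D.str a j :=
  (D.isColimitMap a).fac _ j

/-- The object of the lax limit obtained as the pointwise colimit of a lax diagram. -/
noncomputable def colim : LaxLimit H where
  obj γ := (D.cocone γ).pt
  str a := D.desc a
  str_id γ := D.map_hom_ext _ fun j => by
    rw [ι_desc, str_id, LaxLimit.map_id_naturality]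
  str_comp a b := D.map_hom_ext _ fun j => by
    obtain ⟨j', g, hg, h⟩ := D.exists_lift a j
    rw [ι_desc, h b, LaxLimit.map_comp_naturality_assoc, ← Functor.map_comp_assoc, ι_desc, ← hg,
      Functor.map_comp_assoc, ι_desc]
  str_twoCell t := D.map_hom_ext _ fun j => by
    rw [ι_desc, ← str_twoCell D t, ← ι_desc, ← Category.assoc, ← Category.assoc]
    exact congrArg (· ≫ _) (LaxLimit.map₂_naturality H t _)

/-- Morphisms out of the pointwise colimit of a lax diagram. -/
noncomputable def homMk {M : LaxLimit H} (s : ∀ γ, (D.cocone γ).pt ⟶ M.obj γ)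
    (h : ∀ {γ δ : Γ} (a : γ ⟶ δ) (j : J),
      (H.map a).toFunctor.map ((D.cocone γ).ι.app j ≫ s γ) ≫ M.str a = D.str a j ≫ s δ) :
    D.colim ⟶ M where
  app γ := s γ
  comm a := D.map_hom_ext _ fun j => by
    exact ((Category.assoc _ _ _).symm.trans
      (congrArg (· ≫ M.str a) ((H.map a).toFunctor.map_comp _ _).symm)).trans
      ((h a j).trans ((congrArg (· ≫ s _) (D.ι_desc a j).symm).trans (Category.assoc _ _ _)))

end LaxDiagram

/-! ### Colimits in the lax limit are pointwise. -/

namespace LaxLimit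

variable {Γ : Type w} [Bicategory.{w, w} Γ] {H : StrictPseudofunctor Γ Cat.{w, u}}
  {J : Type v} [Category.{v'} J]

/-- A cocone in the lax limit whose projections are colimit cocones preserved by the functors
`H a` is a colimit cocone. -/
noncomputable def isColimitOfProj {F : J ⥤ LaxLimit H} (c : Cocone F)
    (hc : ∀ γ, IsColimit ((proj H γ).mapCocone c))
    (hp : ∀ {γ δ : Γ} (a : γ ⟶ δ), PreservesColimit (F ⋙ proj H γ) (H.map a).toFunctor) :
    IsColimit c where
  desc s :=
    { app γ := (hc γ).desc ((proj H γ).mapCocone s)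
      comm {γ δ} a := by
        let d (γ : Γ) : c.pt.obj γ ⟶ s.pt.obj γ := (hc γ).desc ((proj H γ).mapCocone s)
        have h (γ : Γ) (j : J) : Hom.app (c.ι.app j) γ ≫ d γ = Hom.app (s.ι.app j) γ :=
          (hc γ).fac ((proj H γ).mapCocone s) j
        have := hp a
        refine (isColimitOfPreserves (H.map a).toFunctor (hc γ)).hom_ext fun j => ?_
        change (H.map a).toFunctor.map (Hom.app (c.ι.app j) γ) ≫
          (H.map a).toFunctor.map (d γ) ≫ s.pt.str a =
          (H.map a).toFunctor.map (Hom.app (c.ι.app j) γ) ≫ c.pt.str a ≫ d δ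
        rw [← Functor.map_comp_assoc, h, hom_comm (M := s.pt), ← h,
          hom_comm_assoc (M := c.pt)] }
  fac s j := hom_ext fun γ => (hc γ).fac ((proj H γ).mapCocone s) j
  uniq s m hm := hom_ext fun γ => (hc γ).uniq ((proj H γ).mapCocone s) _ fun j =>
    congrArg (Hom.app · γ) (hm j)

section

variable (F : J ⥤ LaxLimit H) [∀ γ, HasColimit (F ⋙ proj H γ)]
  (hp : ∀ {γ δ : Γ} (a : γ ⟶ δ), PreservesColimit (F ⋙ proj H γ) (H.map a).toFunctor)

/-- The lax diagram underlying a diagram in the lax limit. -/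
noncomputable def laxDiagram : LaxDiagram H J where
  diag γ := F ⋙ proj H γ
  cocone γ := colimit.cocone _
  isColimit γ := colimit.isColimit _
  preserves a := hp a
  str {γ δ} a j := (F.obj j).str a ≫ colimit.ι (F ⋙ proj H δ) j
  str_naturality {γ δ} a j j' f := by
    exact (hom_comm_assoc (F.map f) a (colimit.ι (F ⋙ proj H δ) j')).trans
      (congrArg _ (colimit.w (F ⋙ proj H δ) f))
  str_id γ j := by rw [(F.obj j).str_id]; rfl
  str_twoCell t j := by
    refine (Category.assoc _ _ _).symm.trans ?_
    exact congrArg (· ≫ _) ((F.obj j).str_twoCell t)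
  exists_lift a j := ⟨j, (F.obj j).str a, rfl, fun b => by
    rw [(F.obj j).str_comp]
    exact (Category.assoc _ _ _).trans (congrArg _ (Category.assoc _ _ _))⟩

/-- The pointwise colimit cocone of a diagram in the lax limit. -/
noncomputable def colimitCocone : Cocone F where
  pt := (laxDiagram F hp).colim
  ι :=
    { app j :=
        { app γ := colimit.ι (F ⋙ proj H γ) j
          comm a := (laxDiagram F hp).ι_desc a j }
      naturality _ _ f := hom_ext fun γ =>
        (colimit.cocone (F ⋙ proj H γ)).ι.naturality f }

/-- The pointwise colimit cocone is a colimit cocone. -/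
noncomputable def isColimitProjColimitCocone (γ : Γ) :
    IsColimit ((proj H γ).mapCocone (colimitCocone F hp)) :=
  colimit.isColimit (F ⋙ proj H γ)

include hp in
theorem hasColimit_of_proj : HasColimit F :=
  ⟨_, isColimitOfProj _ (isColimitProjColimitCocone F hp) hp⟩

include hp in
theorem preservesColimit_proj (γ : Γ) : PreservesColimit F (proj H γ) :=
  preservesColimit_of_preserves_colimit_cocone
    (isColimitOfProj _ (isColimitProjColimitCocone F hp) hp)
    (isColimitProjColimitCocone F hp γ)

end

end LaxLimit

namespace LaxLimit

variable {Γ : Type w} [Bicategory.{w, w} Γ] {H : StrictPseudofunctor Γ Cat.{w, u}}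

theorem hasColimitsOfShape (J : Type v) [Category.{v'} J]
    (h : ∀ γ, HasColimitsOfShape J (H.obj γ))
    (hp : ∀ {γ δ : Γ} (a : γ ⟶ δ), PreservesColimitsOfShape J (H.map a).toFunctor) :
    HasColimitsOfShape J (LaxLimit H) where
  has_colimit F := hasColimit_of_proj F fun a => have := hp a; inferInstance

theorem preservesColimitsOfShape_proj (J : Type v) [Category.{v'} J]
    (h : ∀ γ, HasColimitsOfShape J (H.obj γ))
    (hp : ∀ {γ δ : Γ} (a : γ ⟶ δ), PreservesColimitsOfShape J (H.map a).toFunctor) (γ : Γ) :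
    PreservesColimitsOfShape J (proj H γ) where
  preservesColimit {F} := preservesColimit_proj F (fun a => have := hp a; inferInstance) γ

/-! ### Presentability and smallness of objects with κ-presentable components. -/

section

variable {κ : Cardinal.{w}} [Fact κ.IsRegular] {J : Type w} [SmallCategory J]
  [IsCardinalFiltered J κ] {F : J ⥤ LaxLimit H} {c : Cocone F} {γ : Γ}
  (hc : IsColimit ((proj H γ).mapCocone c)) {X : H.obj γ} (hX : IsCardinalPresentable X κ)

include hc hX

theorem exists_hom_of_isColimit (f : X ⟶ c.pt.obj γ) :
    ∃ (j : J) (g : X ⟶ (F.obj j).obj γ), g ≫ Hom.app (M := c.pt) (c.ι.app j) γ = f :=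
  IsCardinalPresentable.exists_hom_of_isColimit κ hc f

theorem exists_eq_of_isColimit {j : J} (f g : X ⟶ (F.obj j).obj γ)
    (h : f ≫ Hom.app (M := c.pt) (c.ι.app j) γ = g ≫ Hom.app (M := c.pt) (c.ι.app j) γ) :
    ∃ (k : J) (u : j ⟶ k), f ≫ Hom.app (F.map u) γ = g ≫ Hom.app (F.map u) γ :=
  IsCardinalPresentable.exists_eq_of_isColimit' κ hc f g h

end

theorem cocone_w {J : Type v} [Category.{v'} J] {F : J ⥤ LaxLimit H} (c : Cocone F) {j k : J}
    (u : j ⟶ k) (γ : Γ) :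
    Hom.app (F.map u) γ ≫ Hom.app (M := c.pt) (c.ι.app k) γ =
      Hom.app (M := c.pt) (c.ι.app j) γ :=
  congrArg (Hom.app · γ) (c.w u)

theorem functor_map_comp_app {J : Type v} [Category.{v'} J] (F : J ⥤ LaxLimit H) {j k l : J}
    (u : j ⟶ k) (v : k ⟶ l) (γ : Γ) :
    Hom.app (F.map (u ≫ v)) γ = Hom.app (F.map u) γ ≫ Hom.app (F.map v) γ :=
  congrArg (Hom.app · γ) (F.map_comp u v)

/-- An object of the lax limit is `κ`-presentable as soon as its components and their images
under the functors `H a` are. -/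
theorem isCardinalPresentable_of_forall {κ : Cardinal.{w}} [Fact κ.IsRegular]
    (hΓ : IsSmallTwoCategory κ Γ) (hproj : ∀ γ, (proj H γ).IsCardinalAccessible κ)
    (S : LaxLimit H) (hS : ∀ γ, IsCardinalPresentable (S.obj γ) κ)
    (hS' : ∀ {γ δ : Γ} (a : γ ⟶ δ),
      IsCardinalPresentable ((H.map a).toFunctor.obj (S.obj γ)) κ) :
    IsCardinalPresentable S κ := by
  refine ⟨fun J _ _ => ⟨fun {F} => ⟨fun {c} hc => ⟨?_⟩⟩⟩⟩
  have hcγ (γ : Γ) : IsColimit ((proj H γ).mapCocone c) := by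
    have := (hproj γ).preservesColimitOfShape J
    exact isColimitOfPreserves _ hc
  have := isFiltered_of_isCardinalFiltered J κ
  refine Types.FilteredColimit.isColimitOf' _ _ (fun (f : S ⟶ c.pt) => ?_)
    (fun j (f g : S ⟶ F.obj j) hfg => ?_)
  · choose j g hg using fun γ => exists_hom_of_isColimit (hcγ γ) (hS γ) (Hom.app f γ)
    let j₀ := IsCardinalFiltered.max j hΓ.objects
    let t (γ : Γ) : j γ ⟶ j₀ := IsCardinalFiltered.toMax j hΓ.objects γ
    obtain ⟨g', hg'⟩ : ∃ g' : ∀ γ, S.obj γ ⟶ (F.obj j₀).obj γ,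
        ∀ γ, g' γ ≫ Hom.app (M := c.pt) (c.ι.app j₀) γ = Hom.app f γ :=
      ⟨fun γ => g γ ≫ Hom.app (F.map (t γ)) γ, fun γ => by rw [Category.assoc, cocone_w, hg]⟩
    -- The family g' respects the structure maps only after mapping to the colimit. For each 1-cell
    -- a the two sides are maps out of the κ-presentable H(a)(S_γ), so they agree at some later
    -- stage; the wide span below reaches all these stages through one and the same transition map
    -- q.
    have (x : Σ (γ δ : Γ), γ ⟶ δ) : ∃ (k : J) (v : j₀ ⟶ k),
        ((H.map x.2.2).toFunctor.map (g' x.1) ≫ (F.obj j₀).str x.2.2) ≫ Hom.app (F.map v) x.2.1 =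
          (S.str x.2.2 ≫ g' x.2.1) ≫ Hom.app (F.map v) x.2.1 := by
      refine exists_eq_of_isColimit (hcγ x.2.1) (hS' x.2.2) _ _ ?_
      rw [Category.assoc, Category.assoc, hg', ← hom_comm f, ← hg',
        ← hom_comm (M := c.pt) (c.ι.app j₀), Functor.map_comp, Category.assoc]
    choose k v hv using this
    obtain ⟨m, p, q, hpq⟩ := IsCardinalFiltered.wideSpan v hΓ.oneCells
    refine ⟨m, ({ app γ := g' γ ≫ Hom.app (F.map q) γ, comm {γ δ} a := ?_ } : Hom S (F.obj m)),
      hom_ext fun γ => ?_⟩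
    · have h := hv ⟨γ, δ, a⟩ =≫ Hom.app (F.map (p ⟨γ, δ, a⟩)) δ
      dsimp only at h
      rw [Category.assoc, Category.assoc, ← functor_map_comp_app, hpq ⟨γ, δ, a⟩,
        Category.assoc, Category.assoc] at h
      rw [Functor.map_comp, Category.assoc, hom_comm, h, ← functor_map_comp_app, hpq]
    · change _ = (g' γ ≫ Hom.app (F.map q) γ) ≫ Hom.app (M := c.pt) (c.ι.app m) γ
      rw [Category.assoc, cocone_w, hg']
  · have (γ : Γ) : ∃ (k : J) (u : j ⟶ k),
        Hom.app f γ ≫ Hom.app (F.map u) γ = Hom.app g γ ≫ Hom.app (F.map u) γ :=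
      exists_eq_of_isColimit (hcγ γ) (hS γ) _ _ (congrArg (Hom.app · γ) hfg)
    choose k v hv using this
    obtain ⟨m, p, q, hpq⟩ := IsCardinalFiltered.wideSpan v hΓ.objects
    refine ⟨m, q, hom_ext fun γ => ?_⟩
    change Hom.app f γ ≫ Hom.app (F.map q) γ = Hom.app g γ ≫ Hom.app (F.map q) γ
    rw [← hpq γ, functor_map_comp_app, ← Category.assoc, hv, Category.assoc]

/-- An isomorphism in the lax limit from isomorphisms of the components. -/
theorem nonempty_iso_of_forall {S T : LaxLimit H} (e : ∀ γ, S.obj γ ≅ T.obj γ)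
    (h : ∀ {γ δ : Γ} (a : γ ⟶ δ),
      (H.map a).toFunctor.map (e γ).hom ≫ T.str a = S.str a ≫ (e δ).hom) :
    Nonempty (S ≅ T) :=
  ⟨{ hom := { app γ := (e γ).hom, comm := h }
     inv :=
      { app γ := (e γ).inv
        comm {γ δ} a := by
          rw [← Category.comp_id (_ ≫ S.str a), ← (e δ).hom_inv_id, Category.assoc,
            ← Category.assoc (S.str a), ← h, ← Category.assoc, ← Category.assoc,
            ← Functor.map_comp, (e γ).inv_hom_id]
          simp }
     hom_inv_id := hom_ext fun γ => (e γ).hom_inv_id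
     inv_hom_id := hom_ext fun γ => (e γ).inv_hom_id }⟩

/-- If `P γ` is essentially small for every `γ`, then there is only a set of isomorphism classes
of objects of the lax limit with components satisfying `P γ`. -/
theorem essentiallySmall_of_forall (P : ∀ γ, ObjectProperty (H.obj γ))
    [∀ γ, ObjectProperty.EssentiallySmall.{w} (P γ)] :
    ObjectProperty.EssentiallySmall.{w} (fun S : LaxLimit H => ∀ γ, P γ (S.obj γ)) := by
  choose Q hQ hPQ using fun γ =>
    ObjectProperty.EssentiallySmall.exists_small_le' (P γ)
  let T (γ : Γ) (x : Shrink.{w} (Subtype (Q γ))) : H.obj γ := ((equivShrink _).symm x).1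
  -- A small set of raw data, with no lax limit axioms imposed. Only those data isomorphic to an
  -- actual object are retained at the end, one object being chosen for each.
  let D := Σ x : (∀ γ, Shrink.{w} (Subtype (Q γ))), ∀ (γ δ : Γ) (a : γ ⟶ δ),
    ((H.map a).toFunctor.obj (T γ (x γ)) ⟶ T δ (x δ))
  let R (S : LaxLimit H) (d : D) : Prop := ∃ e : ∀ γ, S.obj γ ≅ T γ (d.1 γ),
    ∀ (γ δ : Γ) (a : γ ⟶ δ),
      (H.map a).toFunctor.map (e γ).hom ≫ d.2 γ δ a = S.str a ≫ (e δ).hom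
  have hR (S S' : LaxLimit H) (d : D) : R S d → R S' d → Nonempty (S ≅ S') := by
    rintro ⟨e, he⟩ ⟨e', he'⟩
    refine nonempty_iso_of_forall (fun γ => e γ ≪≫ (e' γ).symm) fun {γ δ} a => ?_
    have h := he γ δ a
    have h' := he' γ δ a
    rw [← cancel_mono (e' δ).hom]
    simp only [Iso.trans_hom, Iso.symm_hom, Functor.map_comp, Category.assoc,
      Iso.inv_hom_id, Category.comp_id, ← h, ← h']
    rw [← Functor.map_comp_assoc (H.map a).toFunctor (e' γ).inv, (e' γ).inv_hom_id]
    simp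
  have hex (S : LaxLimit H) (hS : ∀ γ, P γ (S.obj γ)) : ∃ d, R S d := by
    choose X hX e using fun γ => hPQ γ _ (hS γ)
    let x (γ : Γ) : Shrink.{w} (Subtype (Q γ)) := equivShrink _ ⟨X γ, hX γ⟩
    have hx (γ : Γ) : X γ = T γ (x γ) := by simp [T, x]
    let e' (γ : Γ) : S.obj γ ≅ T γ (x γ) := (e γ).some ≪≫ eqToIso (hx γ)
    exact ⟨⟨x, fun γ δ a => (H.map a).toFunctor.map (e' γ).inv ≫ S.str a ≫ (e' δ).hom⟩, e',
      fun γ δ a => by rw [← Functor.map_comp_assoc, (e' γ).hom_inv_id]; simp⟩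
  refine ⟨.ofObj fun d : {d : D // ∃ S, R S d} => d.2.choose, inferInstance, fun S hS => ?_⟩
  obtain ⟨d, hd⟩ := hex S hS
  exact ⟨_, ⟨⟨d, S, hd⟩⟩, hR _ _ d hd (⟨d, S, hd⟩ : {d : D // ∃ S, R S d}).2.choose_spec⟩

end LaxLimit

/-! ### Transfinite recursion in κ-directed preorders. -/

section Directed

variable {I : Type w} [Preorder I] {κ : Cardinal.{w}} [Fact κ.IsRegular] [IsCardinalFiltered I κ]

variable (κ) in
theorem exists_upper_bound {X : Type w} (f : X → I) (hX : HasCardinalLT X κ) :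
    ∃ j, ∀ x, f x ≤ j :=
  ⟨IsCardinalFiltered.max f hX, fun x => leOfHom (IsCardinalFiltered.toMax f hX x)⟩

variable (κ) in
theorem exists_forall_ge_forall {X : Type w} (hX : HasCardinalLT X κ) {Q : X → I → Prop}
    (h : ∀ x, ∃ k, ∀ j, k ≤ j → Q x j) : ∃ k, ∀ j, k ≤ j → ∀ x, Q x j := by
  choose k hk using h
  obtain ⟨l, hl⟩ := exists_upper_bound κ k hX
  exact ⟨l, fun j hj x => hk x j ((hl x).trans hj)⟩

/-- Given a ternary relation on a `κ`-directed preorder whose last argument can be taken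
arbitrarily large, there is a transfinite sequence of length less than `κ` such that any element
is related to all previous elements and to the elements of a given small family. -/
theorem exists_sequence {R : I → I → I → Prop} (hR : ∀ i i', ∃ k, ∀ j, k ≤ j → R i i' j)
    {T : Type w} [LinearOrder T] [WellFoundedLT T] (hT : HasCardinalLT T κ)
    {X : Type w} (B : X → I) (hX : HasCardinalLT X κ) :
    ∃ c : T → I, ∀ p, ∀ y y' : X ⊕ {m : T // m < p},
      R (Sum.elim B (fun m => c m.1) y) (Sum.elim B (fun m => c m.1) y') (c p) := by
  choose k hk using hR
  have hκ : Cardinal.aleph0 ≤ κ := (Fact.out : κ.IsRegular).aleph0_le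
  let prev {p : T} (f : ∀ m : T, m < p → I) (m : {m : T // m < p}) : I := f m.1 m.2
  -- Before stage p there are fewer than κ elements, hence fewer than κ pairs, and the thresholds k
  -- of all pairs have a common upper bound. The recursion takes this bound as its value at p.
  have (p : T) (f : ∀ m : T, m < p → I) : ∃ j, ∀ y y' : X ⊕ {m : T // m < p},
      k (Sum.elim B (prev f) y) (Sum.elim B (prev f) y') ≤ j := by
    have hY : HasCardinalLT (X ⊕ {m : T // m < p}) κ :=
      (hasCardinalLT_sum_iff _ _ _ hκ).2 ⟨hX, hT.of_injective _ Subtype.val_injective⟩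
    obtain ⟨j, hj⟩ := exists_upper_bound κ
      (fun z : (X ⊕ {m : T // m < p}) × (X ⊕ {m : T // m < p}) =>
        k (Sum.elim B (prev f) z.1) (Sum.elim B (prev f) z.2))
      (hasCardinalLT_prod hκ hY hY)
    exact ⟨j, fun y y' => hj (y, y')⟩
  choose g hg using this
  have hwf : WellFounded (fun a b : T => a < b) := wellFounded_lt
  refine ⟨hwf.fix g, fun p y y' => hk _ _ _ ?_⟩
  rw [hwf.fix_eq g p]
  exact hg p (fun m _ => hwf.fix g m) y y'

end Directed

/-- A family of objects of `κ`-accessible categories can be presented by diagrams of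
`κ`-presentable objects which are all indexed by the same `κ`-directed poset. -/
theorem exists_colimitPresentation_directed {κ : Cardinal.{w}} [Fact κ.IsRegular] {ι : Type w}
    {C : ι → Type u} [∀ i, Category.{v} (C i)] [∀ i, IsCardinalAccessibleCategory (C i) κ]
    (X : ∀ i, C i) :
    ∃ (I : Type w) (_ : PartialOrder I) (_ : IsCardinalFiltered I κ)
      (p : ∀ i, ColimitPresentation I (X i)),
      ∀ i j, IsCardinalPresentable ((p i).diag.obj j) κ := by
  have (i : ι) : ∃ (J : Type w) (_ : SmallCategory J) (_ : IsCardinalFiltered J κ)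
      (p : ColimitPresentation J (X i)), ∀ j, IsCardinalPresentable (p.diag.obj j) κ := by
    obtain ⟨P, _, hP⟩ := HasCardinalFilteredGenerator.exists_generator (C i) κ
    obtain ⟨J, _, _, ⟨q⟩⟩ := hP.exists_colimitsOfShape (X i)
    exact ⟨J, _, ‹_›, q.toColimitPresentation,
      fun j => hP.le_isCardinalPresentable _ (q.prop_diag_obj j)⟩
  choose J hJ hJκ p hp using this
  have (i : ι) : IsFiltered (J i) := isFiltered_of_isCardinalFiltered (J i) κ
  -- The product of the index categories is κ-filtered, so it receives a final functor from a
  -- κ-directed poset; its projections are final too, so each presentation can be reindexed by this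
  -- poset.
  obtain ⟨I, _, _, F, _⟩ := IsCardinalFiltered.exists_cardinal_directed (∀ i, J i) κ
  exact ⟨I, _, ‹_›, fun i => (p i).reindex (F ⋙ Pi.eval J i), fun i j => hp i _⟩

/-! ### Presentations with lifted structure maps, and their eventual compatibilities. -/

namespace LaxLimit

variable {Γ : Type w} [Bicategory.{w, w} Γ] {H : StrictPseudofunctor Γ Cat.{w, u}}

/-- Presentations of the components of an object of the lax limit as colimits indexed by a common
preorder, with lifts of the structure maps to the terms of the presentations. -/
structure Presentation (L : LaxLimit H) (I : Type w) [Preorder I] where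
  pres (γ : Γ) : ColimitPresentation I (L.obj γ)
  next : I → I
  lift {γ δ : Γ} (a : γ ⟶ δ) (i : I) :
    (H.map a).toFunctor.obj ((pres γ).diag.obj i) ⟶ (pres δ).diag.obj (next i)
  lift_app {γ δ : Γ} (a : γ ⟶ δ) (i : I) :
    lift a i ≫ (show (pres δ).diag.obj (next i) ⟶ L.obj δ from (pres δ).ι.app (next i)) =
      (H.map a).toFunctor.map (Y := L.obj γ) ((pres γ).ι.app i) ≫ L.str a

namespace Presentation

variable {L : LaxLimit H} {I : Type w} [Preorder I] (D : Presentation L I)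

/-- The terms of the presentations. -/
abbrev term (γ : Γ) (i : I) : H.obj γ := (D.pres γ).diag.obj i

/-- The transition maps of the presentations. -/
def trans (γ : Γ) {i j : I} (h : i ≤ j) : D.term γ i ⟶ D.term γ j :=
  (D.pres γ).diag.map (homOfLE h)

/-- The maps from the terms of the presentations. -/
def incl (γ : Γ) (i : I) : D.term γ i ⟶ L.obj γ := (D.pres γ).ι.app i

@[simp]
theorem trans_trans (γ : Γ) {i j k : I} (h : i ≤ j) (h' : j ≤ k) :
    D.trans γ h ≫ D.trans γ h' = D.trans γ (h.trans h') :=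
  ((D.pres γ).diag.map_comp _ _).symm

@[simp]
theorem trans_trans_assoc (γ : Γ) {i j k : I} (h : i ≤ j) (h' : j ≤ k) {X : H.obj γ}
    (f : D.term γ k ⟶ X) :
    D.trans γ h ≫ D.trans γ h' ≫ f = D.trans γ (h.trans h') ≫ f := by
  rw [← Category.assoc, trans_trans]

@[simp]
theorem trans_refl (γ : Γ) {i : I} (h : i ≤ i) : D.trans γ h = 𝟙 _ :=
  (D.pres γ).diag.map_id i

@[simp]
theorem trans_incl (γ : Γ) {i j : I} (h : i ≤ j) : D.trans γ h ≫ D.incl γ j = D.incl γ i :=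
  (D.pres γ).w (homOfLE h)

@[simp]
theorem lift_incl {γ δ : Γ} (a : γ ⟶ δ) (i : I) :
    D.lift a i ≫ D.incl δ (D.next i) = (H.map a).toFunctor.map (D.incl γ i) ≫ L.str a :=
  D.lift_app a i

/-- Maps from the terms to a given term, induced by the structure maps. -/
def map {γ δ : Γ} (a : γ ⟶ δ) {i j : I} (h : D.next i ≤ j) :
    (H.map a).toFunctor.obj (D.term γ i) ⟶ D.term δ j :=
  D.lift a i ≫ D.trans δ h

@[simp]
theorem map_trans {γ δ : Γ} (a : γ ⟶ δ) {i j k : I} (h : D.next i ≤ j) (h' : j ≤ k) :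
    D.map a h ≫ D.trans δ h' = D.map a (h.trans h') := by
  simp [map]

@[simp]
theorem map_incl {γ δ : Γ} (a : γ ⟶ δ) {i j : I} (h : D.next i ≤ j) :
    D.map a h ≫ D.incl δ j = (H.map a).toFunctor.map (D.incl γ i) ≫ L.str a := by
  simp [map]

@[simp]
theorem map_trans_assoc {γ δ : Γ} (a : γ ⟶ δ) {i j k : I} (h : D.next i ≤ j) (h' : j ≤ k)
    {X : H.obj δ} (f : D.term δ k ⟶ X) :
    D.map a h ≫ D.trans δ h' ≫ f = D.map a (h.trans h') ≫ f := by
  rw [← Category.assoc, map_trans]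

/-- The compatibilities of the lifted structure maps which hold as soon as the index `j` is large
enough with respect to `i` and `i'`. -/
structure Compatible (i i' j : I) : Prop where
  le : i ≤ j
  next_le : D.next i ≤ j
  next_le' : D.next i' ≤ j
  -- The conditions relating i to i' are conditional, so that the relation can be required of all
  -- pairs of earlier indices, in whatever order they stand.
  naturality (h : i ≤ i') {γ δ : Γ} (a : γ ⟶ δ) :
    (H.map a).toFunctor.map (D.trans γ h) ≫ D.map a next_le' = D.map a next_le
  map_id (γ : Γ) : D.map (𝟙 γ) next_le = eqToHom (map_id_obj H γ _) ≫ D.trans γ le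
  map_comp (h : D.next i ≤ i') {γ δ δ' : Γ} (a : γ ⟶ δ) (b : δ ⟶ δ') :
    D.map (a ≫ b) next_le = eqToHom (map_comp_obj H a b _) ≫
      (H.map b).toFunctor.map (D.map a h) ≫ D.map b next_le'
  map_twoCell {γ δ : Γ} {a b : γ ⟶ δ} (t : a ⟶ b) :
    (H.map₂ t).toNatTrans.app (D.term γ i) ≫ D.map b next_le = D.map a next_le

variable {κ : Cardinal.{w}} [Fact κ.IsRegular] [IsCardinalFiltered I κ]

/-- The equality is asserted at every sufficiently late stage, rather than at one stage, so that
fewer than κ such equalities can be achieved simultaneously. -/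
theorem exists_trans_eq {γ : Γ} {X : H.obj γ} (hX : IsCardinalPresentable X κ) {j : I}
    (f g : X ⟶ D.term γ j) (h : f ≫ D.incl γ j = g ≫ D.incl γ j) :
    ∃ k, ∀ j', k ≤ j' → ∀ h : j ≤ j', f ≫ D.trans γ h = g ≫ D.trans γ h := by
  obtain ⟨k, u, hk⟩ := IsCardinalPresentable.exists_eq_of_isColimit' κ (D.pres γ).isColimit f g h
  replace hk : f ≫ D.trans γ (leOfHom u) = g ≫ D.trans γ (leOfHom u) := hk
  refine ⟨k, fun j' hj' h => ?_⟩
  rw [← D.trans_trans γ (leOfHom u) hj', ← Category.assoc, hk, Category.assoc]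

/-- Existence of the lifts of the structure maps. -/
theorem nonempty_of_colimitPresentation (hΓ : IsSmallTwoCategory κ Γ)
    (p : ∀ γ, ColimitPresentation I (L.obj γ))
    (hp : ∀ {γ δ : Γ} (a : γ ⟶ δ) (i : I),
      IsCardinalPresentable ((H.map a).toFunctor.obj ((p γ).diag.obj i)) κ) :
    ∃ D : Presentation L I, D.pres = p := by
  have h₁ (i : I) (x : Σ (γ δ : Γ), γ ⟶ δ) : ∃ (j : I)
      (g : (H.map x.2.2).toFunctor.obj ((p x.1).diag.obj i) ⟶ (p x.2.1).diag.obj j),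
      g ≫ (show (p x.2.1).diag.obj j ⟶ L.obj x.2.1 from (p x.2.1).ι.app j) =
        (H.map x.2.2).toFunctor.map (Y := L.obj x.1) ((p x.1).ι.app i) ≫ L.str x.2.2 :=
    have := hp x.2.2 i
    IsCardinalPresentable.exists_hom_of_isColimit κ (p x.2.1).isColimit _
  choose j g hg using h₁
  choose e he using fun i => exists_upper_bound κ (j i) hΓ.oneCells
  refine ⟨⟨p, e, fun {γ δ} a i => g i ⟨γ, δ, a⟩ ≫ (p δ).diag.map (homOfLE (he i ⟨γ, δ, a⟩)),
    fun {γ δ} a i => ?_⟩, rfl⟩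
  rw [← hg i ⟨γ, δ, a⟩, Category.assoc]
  exact congrArg _ ((p δ).w (homOfLE (he i ⟨γ, δ, a⟩)))

/-- Each compatibility compares two maps out of a κ-presentable object that become equal in L_δ, by
functoriality, naturality or the axioms of L; so it holds at all late stages. The smallness of Γ
leaves fewer than κ conditions. -/
theorem exists_compatible (hΓ : IsSmallTwoCategory κ Γ)
    (hD : ∀ γ i, IsCardinalPresentable (D.term γ i) κ)
    (hH : ∀ {γ δ : Γ} (a : γ ⟶ δ) (X : H.obj γ), IsCardinalPresentable X κ →
      IsCardinalPresentable ((H.map a).toFunctor.obj X) κ) (i i' : I) :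
    ∃ k, ∀ j, k ≤ j → D.Compatible i i' j := by
  have hκ : Cardinal.aleph0 ≤ κ := (Fact.out : κ.IsRegular).aleph0_le
  -- At j₁ both sides of every condition are already defined; they are compared there and then
  -- pushed forward.
  obtain ⟨j₁, hj₁⟩ := exists_upper_bound κ
    (fun x : ULift.{w} (Fin 3) => ![i, D.next i, D.next i'] x.down)
    (hasCardinalLT_of_finite _ _ hκ)
  have hi : i ≤ j₁ := hj₁ ⟨0⟩
  have hn : D.next i ≤ j₁ := hj₁ ⟨1⟩
  have hn' : D.next i' ≤ j₁ := hj₁ ⟨2⟩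
  have h₁ : ∃ k, ∀ j, k ≤ j → ∀ x : Σ (γ δ : Γ), γ ⟶ δ, ∀ (h : i ≤ i') (hj : j₁ ≤ j),
      ((H.map x.2.2).toFunctor.map (D.trans x.1 h) ≫ D.map x.2.2 hn') ≫ D.trans x.2.1 hj =
        D.map x.2.2 hn ≫ D.trans x.2.1 hj := by
    refine exists_forall_ge_forall κ hΓ.oneCells fun x => ?_
    by_cases h : i ≤ i'
    · obtain ⟨k, hk⟩ := D.exists_trans_eq (hH x.2.2 _ (hD x.1 i))
        ((H.map x.2.2).toFunctor.map (D.trans x.1 h) ≫ D.map x.2.2 hn') (D.map x.2.2 hn) (by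
          rw [Category.assoc, map_incl, map_incl, ← Functor.map_comp_assoc, trans_incl])
      exact ⟨k, fun j hj _ => hk j hj⟩
    -- Here the condition is vacuous and the index i is an arbitrary bound.
    · exact ⟨i, fun _ _ h' => (h h').elim⟩
  have h₂ : ∃ k, ∀ j, k ≤ j → ∀ γ : Γ, ∀ (hj : j₁ ≤ j),
      D.map (𝟙 γ) hn ≫ D.trans γ hj =
        (eqToHom (map_id_obj H γ _) ≫ D.trans γ hi) ≫ D.trans γ hj := by
    refine exists_forall_ge_forall κ hΓ.objects fun γ => ?_
    refine D.exists_trans_eq (hH (𝟙 γ) _ (hD γ i)) _ _ ?_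
    rw [Category.assoc, map_incl, trans_incl, L.str_id, map_id_naturality]
  have h₃ : ∃ k, ∀ j, k ≤ j → ∀ x : Σ y : (Σ (γ δ : Γ), γ ⟶ δ), Σ δ' : Γ, y.2.1 ⟶ δ',
      ∀ (h : D.next i ≤ i') (hj : j₁ ≤ j),
      D.map (x.1.2.2 ≫ x.2.2) hn ≫ D.trans x.2.1 hj =
        (eqToHom (map_comp_obj H x.1.2.2 x.2.2 _) ≫
          (H.map x.2.2).toFunctor.map (D.map x.1.2.2 h) ≫ D.map x.2.2 hn') ≫
            D.trans x.2.1 hj := by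
    refine exists_forall_ge_forall κ ?_ fun x => ?_
    · refine hasCardinalLT_sigma _ _ hΓ.oneCells fun y => ?_
      refine hΓ.oneCells.of_injective (fun z => ⟨y.2.1, z⟩) fun z z' h => ?_
      simpa using h
    · by_cases h : D.next i ≤ i'
      · obtain ⟨k, hk⟩ := D.exists_trans_eq (hH (x.1.2.2 ≫ x.2.2) _ (hD x.1.1 i))
          (D.map (x.1.2.2 ≫ x.2.2) hn) (eqToHom (map_comp_obj H x.1.2.2 x.2.2 _) ≫
            (H.map x.2.2).toFunctor.map (D.map x.1.2.2 h) ≫ D.map x.2.2 hn') (by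
            rw [Category.assoc, Category.assoc, map_incl, map_incl, L.str_comp,
              ← Functor.map_comp_assoc, map_incl, Functor.map_comp, Category.assoc,
              map_comp_naturality_assoc])
        exact ⟨k, fun j hj _ => hk j hj⟩
      · exact ⟨i, fun _ _ h' => (h h').elim⟩
  have h₄ : ∃ k, ∀ j, k ≤ j → ∀ x : Σ (γ δ : Γ) (a b : γ ⟶ δ), a ⟶ b, ∀ (hj : j₁ ≤ j),
      ((H.map₂ x.2.2.2.2).toNatTrans.app (D.term x.1 i) ≫ D.map x.2.2.2.1 hn) ≫
        D.trans x.2.1 hj = D.map x.2.2.1 hn ≫ D.trans x.2.1 hj := by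
    refine exists_forall_ge_forall κ hΓ.twoCells fun x => ?_
    refine D.exists_trans_eq (hH x.2.2.1 _ (hD x.1 i)) _ _ ?_
    rw [Category.assoc, map_incl, map_incl, ← L.str_twoCell x.2.2.2.2, map₂_naturality_assoc]
  obtain ⟨k₁, h₁⟩ := h₁
  obtain ⟨k₂, h₂⟩ := h₂
  obtain ⟨k₃, h₃⟩ := h₃
  obtain ⟨k₄, h₄⟩ := h₄
  obtain ⟨k, hk⟩ := exists_upper_bound κ
    (fun x : ULift.{w} (Fin 5) => ![j₁, k₁, k₂, k₃, k₄] x.down)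
    (hasCardinalLT_of_finite _ _ hκ)
  refine ⟨k, fun j hj => ?_⟩
  have hj₁ : j₁ ≤ j := (hk ⟨0⟩).trans hj
  replace h₁ := h₁ j ((hk ⟨1⟩).trans hj)
  replace h₂ := h₂ j ((hk ⟨2⟩).trans hj)
  replace h₃ := h₃ j ((hk ⟨3⟩).trans hj)
  replace h₄ := h₄ j ((hk ⟨4⟩).trans hj)
  exact
    { le := hi.trans hj₁
      next_le := hn.trans hj₁
      next_le' := hn'.trans hj₁
      naturality := fun h γ δ a => by simpa using h₁ ⟨γ, δ, a⟩ h hj₁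
      map_id := fun γ => by simpa using h₂ γ hj₁
      map_comp := fun h γ δ δ' a b => by simpa using h₃ ⟨⟨γ, δ, a⟩, δ', b⟩ h hj₁
      map_twoCell := fun {γ δ a b} t => by simpa using h₄ ⟨γ, δ, a, b, t⟩ hj₁ }

end Presentation

end LaxLimit

/-! ### Objects of the lax limit obtained from chains of indices. -/

namespace LaxLimit.Presentation

variable {Γ : Type w} [Bicategory.{w, w} Γ] {H : StrictPseudofunctor Γ Cat.{w, u}}
  {L : LaxLimit H} {I : Type w} [Preorder I]

/-- A chain of indices of a presentation along which the lifted structure maps are compatible. -/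
structure Chain (D : Presentation L I) (T : Type w) [LinearOrder T] where
  idx : T → I
  compatible {m n q : T} (hm : m < q) (hn : n < q) : D.Compatible (idx m) (idx n) (idx q)

namespace Chain

variable {D : Presentation L I} {T : Type w} [LinearOrder T] (c : D.Chain T)

theorem monotone : Monotone c.idx := fun _ _ h =>
  h.eq_or_lt.elim (fun h => h ▸ le_rfl) (fun h => (c.compatible h h).le)

theorem next_le {m n : T} (h : m < n) : D.next (c.idx m) ≤ c.idx n := (c.compatible h h).next_le

/-- The diagram of terms of a presentation given by a chain. -/
def diag (γ : Γ) : T ⥤ H.obj γ := c.monotone.functor ⋙ (D.pres γ).diag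

section

variable {κ : Cardinal.{w}} [Fact κ.IsRegular] [IsCardinalFiltered I κ] [WellFoundedLT T]
  (hT : HasCardinalLT T κ) (hD : ∀ i i', ∃ k, ∀ j, k ≤ j → D.Compatible i i' j)

include hT hD

/-- The family B places the chain beyond prescribed indices. The last clause provides what is needed
to map the terms at those indices compatibly into the new chain. -/
theorem exists_chain {X : Type w} (B : X → I) (hX : HasCardinalLT X κ) :
    ∃ c : D.Chain T, (∀ x m, B x ≤ c.idx m) ∧ (∀ x m, D.next (B x) ≤ c.idx m) ∧
      ∀ x m q, m < q → D.Compatible (B x) (c.idx m) (c.idx q) := by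
  obtain ⟨c, hc⟩ := exists_sequence hD hT B hX
  exact ⟨⟨c, fun {m n q} hm hn => hc q (.inr ⟨m, hm⟩) (.inr ⟨n, hn⟩)⟩,
    fun x m => (hc m (.inl x) (.inl x)).le, fun x m => (hc m (.inl x) (.inl x)).next_le,
    fun x m q h => hc q (.inl x) (.inr ⟨m, h⟩)⟩

theorem exists_idx_ge (i : I) (m : T) : ∃ c : D.Chain T, i ≤ c.idx m := by
  obtain ⟨c, h, -⟩ := exists_chain hT hD (fun _ : PUnit.{w + 1} => i)
    (hasCardinalLT_of_finite _ _ (Fact.out : κ.IsRegular).aleph0_le)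
  exact ⟨c, h ⟨⟩ m⟩

end

variable [∀ γ, HasColimitsOfShape T (H.obj γ)]

/-- The colimit of a chain of terms of a presentation. -/
noncomputable def pt (γ : Γ) : H.obj γ := colimit (c.diag γ)

/-- The maps from the terms of a chain to its colimit. -/
noncomputable def ι (γ : Γ) (n : T) : D.term γ (c.idx n) ⟶ c.pt γ := colimit.ι (c.diag γ) n

theorem trans_ι_of_le (γ : Γ) {m n : T} (h : m ≤ n) (h' : c.idx m ≤ c.idx n) :
    D.trans γ h' ≫ c.ι γ n = c.ι γ m :=
  colimit.w (c.diag γ) (homOfLE h)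

theorem trans_ι (γ : Γ) {i : I} {m n : T} (h : i ≤ c.idx m) (h' : i ≤ c.idx n) :
    D.trans γ h ≫ c.ι γ m = D.trans γ h' ≫ c.ι γ n := by
  rw [← c.trans_ι_of_le γ (le_max_left m n) (c.monotone (le_max_left m n)),
    ← c.trans_ι_of_le γ (le_max_right m n) (c.monotone (le_max_right m n)),
    trans_trans_assoc, trans_trans_assoc]

theorem map_ι {γ δ : Γ} (a : γ ⟶ δ) {i : I} {m n : T} (h : D.next i ≤ c.idx m)
    (h' : D.next i ≤ c.idx n) : D.map a h ≫ c.ι δ m = D.map a h' ≫ c.ι δ n := by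
  rw [Presentation.map, Presentation.map, Category.assoc, Category.assoc, c.trans_ι δ h h']

variable {c} in
theorem pt_hom_ext {γ : Γ} {X : H.obj γ} {f g : c.pt γ ⟶ X}
    (h : ∀ n, c.ι γ n ≫ f = c.ι γ n ≫ g) : f = g :=
  colimit.hom_ext h

theorem exists_desc {γ : Γ} {X : H.obj γ} (f : ∀ n, D.term γ (c.idx n) ⟶ X)
    (hf : ∀ {m n} (h : m ≤ n), D.trans γ (c.monotone h) ≫ f n = f m) :
    ∃ g : c.pt γ ⟶ X, ∀ n, c.ι γ n ≫ g = f n :=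
  ⟨colimit.desc (c.diag γ) ⟨X,
    { app n := f n
      naturality _ _ u := (hf (leOfHom u)).trans (Category.comp_id _).symm }⟩,
    fun n => colimit.ι_desc _ n⟩

variable [NoMaxOrder T]

/-- The structure maps from the terms of a chain to its colimit. -/
noncomputable def str {γ δ : Γ} (a : γ ⟶ δ) (n : T) :
    (H.map a).toFunctor.obj (D.term γ (c.idx n)) ⟶ c.pt δ :=
  D.map a (c.next_le (exists_gt n).choose_spec) ≫ c.ι δ (exists_gt n).choose

/-- The stage chosen in `str` is irrelevant, so it may be replaced by one late enough for the
compatibility in use. -/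
theorem str_eq {γ δ : Γ} (a : γ ⟶ δ) {n m : T} (h : D.next (c.idx n) ≤ c.idx m) :
    c.str a n = D.map a h ≫ c.ι δ m := c.map_ι a _ _

variable [∀ (γ δ : Γ) (a : γ ⟶ δ), PreservesColimitsOfShape T (H.map a).toFunctor]

/-- The lax diagram attached to a chain. -/
noncomputable def laxDiagram : LaxDiagram H T where
  diag γ := c.diag γ
  cocone γ := colimit.cocone (c.diag γ)
  isColimit γ := colimit.isColimit (c.diag γ)
  preserves a := inferInstance
  str a n := c.str a n
  str_naturality {γ δ} a m n f := by
    obtain ⟨q, hq⟩ := exists_gt n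
    have hm : m < q := (leOfHom f).trans_lt hq
    rw [c.str_eq a (c.next_le hq), c.str_eq a (c.next_le hm),
      ← (c.compatible hm hq).naturality (c.monotone (leOfHom f)) a]
    exact (Category.assoc _ _ _).symm
  str_id γ n := by
    obtain ⟨q, hq⟩ := exists_gt n
    rw [c.str_eq (𝟙 γ) (c.next_le hq), (c.compatible hq hq).map_id, Category.assoc,
      c.trans_ι_of_le γ hq.le]
    rfl
  str_twoCell {γ δ a b} t n := by
    obtain ⟨q, hq⟩ := exists_gt n
    rw [c.str_eq a (c.next_le hq), c.str_eq b (c.next_le hq),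
      ← (c.compatible hq hq).map_twoCell t]
    exact (Category.assoc _ _ _).symm
  exists_lift {γ δ} a n := by
    obtain ⟨m, hm⟩ := exists_gt n
    obtain ⟨q, hq⟩ := exists_gt m
    refine ⟨m, D.map a (c.next_le hm), (c.str_eq a _).symm, fun b => ?_⟩
    rw [c.str_eq (a ≫ b) (c.next_le (hm.trans hq)), c.str_eq b (c.next_le hq),
      (c.compatible (hm.trans hq) hq).map_comp (c.next_le hm) a b]
    exact (Category.assoc _ _ _).trans (congrArg _ (Category.assoc _ _ _))

/-- The object of the lax limit attached to a chain. -/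
noncomputable def obj : LaxLimit H := c.laxDiagram.colim

theorem map_ι_obj_str {γ δ : Γ} (a : γ ⟶ δ) (n : T) :
    (H.map a).toFunctor.map (Y := c.obj.obj γ) (c.ι γ n) ≫ c.obj.str a = c.str a n :=
  c.laxDiagram.ι_desc a n

theorem exists_hom {M : LaxLimit H} (s : ∀ γ, c.pt γ ⟶ M.obj γ)
    (h : ∀ {γ δ : Γ} (a : γ ⟶ δ) (n : T),
      (H.map a).toFunctor.map (c.ι γ n ≫ s γ) ≫ M.str a = c.str a n ≫ s δ) :
    ∃ f : c.obj ⟶ M, ∀ γ, Hom.app (L := c.obj) f γ = s γ :=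
  ⟨c.laxDiagram.homMk s h, fun _ => rfl⟩

/-- The component of a morphism out of the object attached to a chain. -/
abbrev app {c : D.Chain T} {M : LaxLimit H} (f : c.obj ⟶ M) (γ : Γ) : c.pt γ ⟶ M.obj γ :=
  Hom.app f γ

/-- The component of a morphism between the objects attached to chains. -/
abbrev app₂ {c c' : D.Chain T} (f : c.obj ⟶ c'.obj) (γ : Γ) : c.pt γ ⟶ c'.pt γ :=
  Hom.app f γ

/-- A κ-small colimit of κ-presentable objects is κ-presentable, and an arrow of T is determined by
its endpoints, so T has fewer than κ arrows. -/
theorem isCardinalPresentable_obj {κ : Cardinal.{w}} [Fact κ.IsRegular]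
    (hT : HasCardinalLT T κ)
    (hD' : ∀ γ i, IsCardinalPresentable (D.term γ i) κ) (γ : Γ) :
    IsCardinalPresentable (c.obj.obj γ) κ := by
  have (n : T) : IsCardinalPresentable ((c.diag γ).obj n) κ := hD' γ (c.idx n)
  refine isCardinalPresentable_of_isColimit _ (colimit.isColimit (c.diag γ)) κ ?_
  refine (hasCardinalLT_prod (Fact.out : κ.IsRegular).aleph0_le hT hT).of_injective
    (fun f : Arrow T => (f.left, f.right)) fun f g h => ?_
  obtain ⟨x, y, f⟩ := f
  obtain ⟨x', y', g⟩ := g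
  obtain ⟨rfl, rfl⟩ := Prod.mk.inj h
  obtain rfl : f = g := Subsingleton.elim _ _
  rfl

theorem exists_toObj : ∃ f : c.obj ⟶ L, ∀ γ n, c.ι γ n ≫ app f γ = D.incl γ (c.idx n) := by
  choose s hs using fun γ => c.exists_desc (fun n => D.incl γ (c.idx n))
    (fun h => D.trans_incl γ (c.monotone h))
  obtain ⟨f, hf⟩ := c.exists_hom s fun {γ δ} a n => by
    obtain ⟨q, hq⟩ := exists_gt n
    rw [hs, c.str_eq a (c.next_le hq), Category.assoc, hs, map_incl]
  exact ⟨f, fun γ n => (congrArg _ (hf γ)).trans (hs γ n)⟩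

/-- The canonical morphism from the object attached to a chain. -/
noncomputable def toObj : c.obj ⟶ L := c.exists_toObj.choose

theorem ι_toObj (γ : Γ) (n : T) : c.ι γ n ≫ app c.toObj γ = D.incl γ (c.idx n) :=
  c.exists_toObj.choose_spec γ n

/-! ### The κ-directed preorder of chains and its colimit. -/

/-- Morphisms between the objects attached to two chains which are given by the transition maps
of the presentations. -/
def IsTransition {c c' : D.Chain T} (f : c.obj ⟶ c'.obj) : Prop :=
  ∀ n, ∃ (m : T) (h : c.idx n ≤ c'.idx m),
    ∀ γ, c.ι γ n ≫ app₂ f γ = D.trans γ h ≫ c'.ι γ m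

theorem IsTransition.ι_app {c c' : D.Chain T} {f : c.obj ⟶ c'.obj} (hf : IsTransition f)
    (γ : Γ) {n m : T} (h : c.idx n ≤ c'.idx m) :
    c.ι γ n ≫ app₂ f γ = D.trans γ h ≫ c'.ι γ m := by
  obtain ⟨m', h', hm⟩ := hf n
  rw [hm, c'.trans_ι]

/-- This uniqueness is what makes the assignment of objects to chains functorial on a mere preorder.
-/
theorem IsTransition.ext {c c' : D.Chain T} {f g : c.obj ⟶ c'.obj} (hf : IsTransition f)
    (hg : IsTransition g) : f = g := by
  refine LaxLimit.hom_ext fun γ => pt_hom_ext (c := c) (f := app₂ f γ) (g := app₂ g γ) fun n => ?_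
  obtain ⟨m, h, hm⟩ := hf n
  rw [hm, hg.ι_app]

theorem isTransition_id (c : D.Chain T) : IsTransition (𝟙 c.obj) := fun n =>
  ⟨n, le_rfl, fun γ => by
    rw [trans_refl]
    exact (Category.comp_id _).trans (Category.id_comp _).symm⟩

theorem IsTransition.comp {c c' c'' : D.Chain T} {f : c.obj ⟶ c'.obj} {g : c'.obj ⟶ c''.obj}
    (hf : IsTransition f) (hg : IsTransition g) : IsTransition (f ≫ g) := fun n => by
  obtain ⟨m, h, hm⟩ := hf n
  obtain ⟨q, h', hq⟩ := hg m
  refine ⟨q, h.trans h', fun γ => ?_⟩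
  change c.ι γ n ≫ app₂ f γ ≫ app₂ g γ = _
  rw [← Category.assoc, hm, Category.assoc, hq, trans_trans_assoc]

theorem IsTransition.comp_toObj {c c' : D.Chain T} {f : c.obj ⟶ c'.obj}
    (hf : IsTransition f) : f ≫ c'.toObj = c.toObj :=
  LaxLimit.hom_ext fun γ => pt_hom_ext (c := c) (f := app₂ f γ ≫ app c'.toObj γ)
    (g := app c.toObj γ) fun n => by
      obtain ⟨m, h, hm⟩ := hf n
      rw [← Category.assoc, hm, Category.assoc, ι_toObj, ι_toObj, trans_incl]

noncomputable instance : Preorder (D.Chain T) where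
  le c c' := ∃ f : c.obj ⟶ c'.obj, IsTransition f
  le_refl c := ⟨_, c.isTransition_id⟩
  le_trans _ _ _ h h' := ⟨_, h.choose_spec.comp h'.choose_spec⟩

/-- The whole chain c is sent through the single term of c' at m. The square with the structure maps
commutes by naturality for the pair formed by a term of c and that term, witnessed at any later q.
-/
theorem le_of_compatible {c c' : D.Chain T} {m : T} (hm : ∀ n, c.idx n ≤ c'.idx m)
    (hm' : ∀ n, D.next (c.idx n) ≤ c'.idx m)
    (h : ∀ n q, m < q → D.Compatible (c.idx n) (c'.idx m) (c'.idx q)) : c ≤ c' := by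
  choose s hs using fun γ => c.exists_desc (fun n => D.trans γ (hm n) ≫ c'.ι γ m)
    (fun h => by rw [trans_trans_assoc])
  obtain ⟨f, hf⟩ := c.exists_hom (M := c'.obj) s fun {γ δ} a n => by
    obtain ⟨p, hp⟩ := exists_gt n
    obtain ⟨q, hq⟩ := exists_gt m
    have h₁ : c.str a n ≫ s δ = D.map a (hm' n) ≫ c'.ι δ m := by
      rw [c.str_eq a (c.next_le hp), Category.assoc, hs, map_trans_assoc]
    have h₂ : (H.map a).toFunctor.map (c.ι γ n ≫ s γ) =
      (H.map a).toFunctor.map (D.trans γ (hm n)) ≫ (H.map a).toFunctor.map (c'.ι γ m) := by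
      rw [hs, Functor.map_comp]
    refine ((congrArg (· ≫ c'.obj.str a) h₂).trans (Category.assoc _ _ _)).trans ?_
    have h₃ : (H.map a).toFunctor.map (D.trans γ (hm n)) ≫ c'.str a m =
        D.map a (hm' n) ≫ c'.ι δ m := by
      rw [c'.str_eq a (c'.next_le hq), ← Category.assoc, (h n q hq).naturality (hm n) a]
      exact c'.map_ι a _ _
    exact (congrArg _ (c'.map_ι_obj_str a m)).trans (h₃.trans h₁.symm)
  exact ⟨f, fun n => ⟨m, hm n, fun γ => (congrArg _ (hf γ)).trans (hs γ n)⟩⟩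

variable (D T) in
/-- The functor sending a chain to the corresponding object of the lax limit. -/
noncomputable def functor : D.Chain T ⥤ LaxLimit H where
  obj c := c.obj
  map h := (leOfHom h).choose
  map_id c := (leOfHom (𝟙 c)).choose_spec.ext c.isTransition_id
  map_comp f g := (leOfHom (f ≫ g)).choose_spec.ext
    ((leOfHom f).choose_spec.comp (leOfHom g).choose_spec)

theorem isTransition_functor_map {c c' : D.Chain T} (h : c ⟶ c') :
    IsTransition ((functor D T).map h) := (leOfHom h).choose_spec

variable (D T) in
/-- The cocone over the objects attached to all chains. -/
noncomputable def cocone : Cocone (functor D T) where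
  pt := L
  ι :=
    { app c := c.toObj
      naturality _ _ h :=
        (isTransition_functor_map h).comp_toObj.trans (Category.comp_id _).symm }

section

variable {κ : Cardinal.{w}} [Fact κ.IsRegular] [IsCardinalFiltered I κ]
  [WellFoundedLT T] [Nonempty T] (hT : HasCardinalLT T κ)
  (hD : ∀ i i', ∃ k, ∀ j, k ≤ j → D.Compatible i i' j)

include hT hD in
-- Fewer than κ chains, each with fewer than κ terms, involve fewer than κ indices in total, and a
-- new chain can be started beyond all of them.
theorem isCardinalFiltered : IsCardinalFiltered (D.Chain T) κ :=
  isCardinalFiltered_preorder _ _ fun X c hX => by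
    have hX' : HasCardinalLT X κ := (hasCardinalLT_iff_cardinal_mk_lt _ _).2 hX
    obtain ⟨c', h₁, h₂, h₃⟩ := exists_chain (D := D) hT hD (fun x : X × T => (c x.1).idx x.2)
      (hasCardinalLT_prod (Fact.out : κ.IsRegular).aleph0_le hX' hT)
    obtain ⟨m⟩ := ‹Nonempty T›
    exact ⟨c', fun x => le_of_compatible (m := m) (fun n => h₁ (x, n) m)
      (fun n => h₂ (x, n) m) fun n q hq => h₃ (x, n) m q hq⟩

include hT hD in
/-- The components of an object of the lax limit are colimits of the components of the objects
attached to chains. -/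
theorem nonempty_isColimit_proj (γ : Γ) :
    Nonempty (IsColimit ((proj H γ).mapCocone (cocone D T))) := by
  have := isCardinalFiltered (D := D) hT hD
  obtain ⟨m⟩ := ‹Nonempty T›
  choose c hc using fun i => exists_idx_ge (D := D) hT hD i m
  -- The map from the term at i to the apex of s does not depend on the chain or the stage through
  -- which it passes: two chains are compared inside a common upper bound. These maps then form a
  -- cocone over I, which determines the map out of L_γ.
  have key (s : Cocone (functor D T ⋙ proj H γ)) (i : I) (c₁ c₂ : D.Chain T) (m₁ m₂ : T)
      (h₁ : i ≤ c₁.idx m₁) (h₂ : i ≤ c₂.idx m₂) :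
      D.trans γ h₁ ≫ c₁.ι γ m₁ ≫ (show c₁.pt γ ⟶ s.pt from s.ι.app c₁) =
        D.trans γ h₂ ≫ c₂.ι γ m₂ ≫ (show c₂.pt γ ⟶ s.pt from s.ι.app c₂) := by
    have := isFiltered_of_isCardinalFiltered (D.Chain T) κ
    have aux (c₁ c₃ : D.Chain T) (u : c₁ ⟶ c₃) (m₁ m₃ : T) (h₁ : i ≤ c₁.idx m₁)
        (h₃ : i ≤ c₃.idx m₃) :
        D.trans γ h₁ ≫ c₁.ι γ m₁ ≫ (show c₁.pt γ ⟶ s.pt from s.ι.app c₁) =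
          D.trans γ h₃ ≫ c₃.ι γ m₃ ≫ (show c₃.pt γ ⟶ s.pt from s.ι.app c₃) := by
      have hs : (show c₁.pt γ ⟶ s.pt from s.ι.app c₁) =
          app₂ ((functor D T).map u) γ ≫ (show c₃.pt γ ⟶ s.pt from s.ι.app c₃) := (s.w u).symm
      obtain ⟨q, hq, hq'⟩ := isTransition_functor_map u m₁
      have h := hq' γ
      rw [hs, ← Category.assoc (c₁.ι γ m₁), h, Category.assoc, trans_trans_assoc,
        ← Category.assoc, c₃.trans_ι γ (h₁.trans hq) h₃, Category.assoc]
    let c₃ := IsFiltered.max c₁ c₂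
    -- Only i ≤ c₃.idx q is needed, so the stage q obtained from c₁ serves for both comparisons.
    obtain ⟨q, hq, -⟩ := isTransition_functor_map (IsFiltered.leftToMax c₁ c₂) m₁
    exact (aux c₁ c₃ (IsFiltered.leftToMax c₁ c₂) m₁ q h₁ (h₁.trans hq)).trans
      (aux c₂ c₃ (IsFiltered.rightToMax c₁ c₂) m₂ q h₂ (h₁.trans hq)).symm
  have hdesc (s : Cocone (functor D T ⋙ proj H γ)) : ∃ f : L.obj γ ⟶ s.pt, ∀ i,
      D.incl γ i ≫ f = D.trans γ (hc i) ≫ (c i).ι γ m ≫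
        (show (c i).pt γ ⟶ s.pt from s.ι.app (c i)) :=
    ⟨(D.pres γ).isColimit.desc ⟨s.pt,
      { app i := D.trans γ (hc i) ≫ (c i).ι γ m ≫
          (show (c i).pt γ ⟶ s.pt from s.ι.app (c i))
        naturality i j h := by
          refine Eq.trans ?_ ((key s i (c j) (c i) m m ((leOfHom h).trans (hc j)) (hc i)).trans
            (Category.comp_id _).symm)
          exact D.trans_trans_assoc γ (leOfHom h) (hc j) _ }⟩,
      fun i => (D.pres γ).isColimit.fac _ i⟩
  choose d hd using hdesc
  have hfac (s : Cocone (functor D T ⋙ proj H γ)) (c' : D.Chain T) :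
      app c'.toObj γ ≫ d s = (show c'.pt γ ⟶ s.pt from s.ι.app c') := pt_hom_ext fun n => by
    rw [← Category.assoc, ι_toObj, hd, key s _ (c (c'.idx n)) c' m n (hc _) le_rfl, trans_refl,
      Category.id_comp]
  have huniq (s : Cocone (functor D T ⋙ proj H γ)) (f : L.obj γ ⟶ s.pt)
      (hf : ∀ c' : D.Chain T, app c'.toObj γ ≫ f = (show c'.pt γ ⟶ s.pt from s.ι.app c')) :
      f = d s := by
    refine (D.pres γ).isColimit.hom_ext fun i => ?_
    change D.incl γ i ≫ f = D.incl γ i ≫ d s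
    rw [← D.trans_incl γ (hc i), ← ι_toObj, Category.assoc, Category.assoc, Category.assoc,
      Category.assoc, hf, hfac]
  exact ⟨{ desc := d, fac := hfac, uniq := huniq }⟩

end

end Chain

end LaxLimit.Presentation

/-! ### Accessibility of the lax limit and its presentable objects. -/

namespace LaxLimit

variable {κ lam : Cardinal.{w}} [Fact κ.IsRegular] {Γ : Type w} [Bicategory.{w, w} Γ]
  {H : StrictPseudofunctor Γ Cat.{w, u}}

theorem proj_isCardinalAccessible (hC : ∀ γ, IsAccCategory κ lam (H.obj γ))
    (hF : ∀ {γ δ : Γ} (a : γ ⟶ δ), IsAccFunctor κ lam (H.map a).toFunctor) (γ : Γ) :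
    (proj H γ).IsCardinalAccessible κ where
  preservesColimitOfShape J _ _ :=
    preservesColimitsOfShape_proj J
      (fun γ => (hC γ).accessible.toHasCardinalFilteredColimits.hasColimitsOfShape J)
      (fun a => (hF a).directedColimits.preservesColimitOfShape J) γ

/-- Objects with `κ`-presentable components generate the lax limit under `κ`-filtered colimits. -/
theorem isCardinalFilteredGenerator (hlam : Cardinal.aleph0 ≤ lam) (hlamκ : lam < κ)
    (hΓ : IsSmallTwoCategory κ Γ) (hC : ∀ γ, IsAccCategory κ lam (H.obj γ))
    (hF : ∀ {γ δ : Γ} (a : γ ⟶ δ), IsAccFunctor κ lam (H.map a).toFunctor) :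
    ObjectProperty.IsCardinalFilteredGenerator
      (fun S : LaxLimit H => ∀ γ, isCardinalPresentable (H.obj γ) κ (S.obj γ)) κ where
  le_isCardinalPresentable S hS := isCardinalPresentable_of_forall hΓ
    (proj_isCardinalAccessible hC hF) S hS fun a => (hF a).presentable _ (hS _)
  exists_colimitsOfShape L := by
    have (γ : Γ) := (hC γ).accessible
    have (γ : Γ) := (hC γ).chains
    have (γ δ : Γ) (a : γ ⟶ δ) := (hF a).chains
    obtain ⟨I, _, _, p, hp⟩ := exists_colimitPresentation_directed (κ := κ) L.obj
    obtain ⟨D, rfl⟩ := Presentation.nonempty_of_colimitPresentation hΓ p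
      fun a i => (hF a).presentable _ (hp _ i)
    have hT : HasCardinalLT lam.ord.ToType κ := by
      rw [hasCardinalLT_iff_cardinal_mk_lt, Cardinal.mk_ord_toType]
      exact hlamκ
    have : NoMaxOrder lam.ord.ToType := Cardinal.noMaxOrder hlam
    have : Nonempty lam.ord.ToType := by
      rw [← Cardinal.mk_ne_zero_iff, Cardinal.mk_ord_toType]
      exact (Cardinal.aleph0_pos.trans_le hlam).ne'
    have hD := D.exists_compatible hΓ hp fun a => (hF a).presentable
    have := Presentation.Chain.isCardinalFiltered hT hD
    refine ⟨D.Chain lam.ord.ToType, inferInstance, this, ⟨{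
      diag := Presentation.Chain.functor D lam.ord.ToType
      ι := (Presentation.Chain.cocone D lam.ord.ToType).ι
      isColimit := isColimitOfProj (Presentation.Chain.cocone D lam.ord.ToType)
        (fun γ => (Presentation.Chain.nonempty_isColimit_proj hT hD γ).some)
        fun a => ?_
      prop_diag_obj := fun c γ => c.isCardinalPresentable_obj hT hp γ }⟩⟩
    have := (hF a).directedColimits.preservesColimitOfShape (D.Chain lam.ord.ToType)
    infer_instance

theorem isAccCategory_and_isAccFunctor_proj (hlam : Cardinal.aleph0 ≤ lam) (hlamκ : lam < κ)
    (hΓ : IsSmallTwoCategory κ Γ) (hC : ∀ γ, IsAccCategory κ lam (H.obj γ))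
    (hF : ∀ {γ δ : Γ} (a : γ ⟶ δ), IsAccFunctor κ lam (H.map a).toFunctor) :
    IsAccCategory κ lam (LaxLimit H) ∧ (∀ γ : Γ, IsAccFunctor κ lam (proj H γ)) ∧
      ∀ S : LaxLimit H, IsCardinalPresentable S κ ↔
        ∀ γ : Γ, IsCardinalPresentable ((proj _ γ).obj S) κ := by
  have hG := isCardinalFilteredGenerator hlam hlamκ hΓ hC hF
  have hS (S : LaxLimit H) : IsCardinalPresentable S κ ↔
      ∀ γ : Γ, IsCardinalPresentable ((proj _ γ).obj S) κ := by
    refine ⟨fun h γ => ?_, hG.le_isCardinalPresentable S⟩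
    -- A κ-presentable object is a retract of a generator, whose components are κ-presentable; the
    -- projection carries the retraction to H(γ), where retracts of κ-presentable objects are
    -- κ-presentable.
    have h' := hG.isPresentable_eq_retractClosure.le S h
    obtain ⟨T, hT, ⟨r⟩⟩ := h'
    have : IsCardinalPresentable ((proj H γ).obj T) κ := hT γ
    exact (r.map (proj H γ)).isCardinalPresentable κ
  have (γ : Γ) := (hC γ).accessible
  have := essentiallySmall_of_forall fun γ : Γ => isCardinalPresentable (H.obj γ) κ
  exact ⟨
    { accessible :=
        { exists_generator := ⟨_, this, hG⟩
          hasColimitsOfShape J _ _ := hasColimitsOfShape J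
            (fun γ => (hC γ).accessible.toHasCardinalFilteredColimits.hasColimitsOfShape J)
            fun a => (hF a).directedColimits.preservesColimitOfShape J }
      chains := hasColimitsOfShape _ (fun γ => (hC γ).chains) fun a => (hF a).chains },
    fun γ =>
      { directedColimits := proj_isCardinalAccessible hC hF γ
        chains := preservesColimitsOfShape_proj _ (fun γ => (hC γ).chains)
          (fun a => (hF a).chains) γ
        presentable := fun X hX => (hS X).1 hX γ }, hS⟩

end LaxLimit

theorem theorem7p2 (κ lam : Cardinal.{w}) [Fact κ.IsRegular]
    (hlam : Cardinal.aleph0 ≤ lam) (hlamκ : lam < κ)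
    (Γ : Type w) [Bicategory.{w, w} Γ] [Bicategory.Strict Γ] (hΓ : IsSmallTwoCategory κ Γ)
    (H : StrictPseudofunctor Γ (AccCat.{w, u} κ lam)) :
    IsAccCategory κ lam (LaxLimit (H.comp (AccCat.inclusion κ lam))) ∧
    (∀ γ : Γ, IsAccFunctor κ lam (LaxLimit.proj (H.comp (AccCat.inclusion κ lam)) γ)) ∧
    (∀ S : LaxLimit (H.comp (AccCat.inclusion κ lam)),
      IsCardinalPresentable S κ ↔
        ∀ γ : Γ, IsCardinalPresentable ((LaxLimit.proj _ γ).obj S) κ) :=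
  LaxLimit.isAccCategory_and_isAccFunctor_proj hlam hlamκ hΓ (fun γ => (H.obj γ).prop)
    fun a => (H.map a).prop
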